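/- Write $(a)_k=a(a+1)\cdots(a+k-1)$. Let $\alpha,\beta,\gamma\in\mathbb{C}$ with $\gamma\notin\{0,-1,-2,\dots\}$, let $m_1,\dots,m_r$ be positive integers, $n=m_1+\cdots+m_r$, and let $e_1,\dots,e_r\in\mathbb{C}$ with $(e_i)_{m_i}\neq 0$ for all $i$ (so in particular $e_i\ne 0$). For $e\in\mathbb{C}$ and a positive integer $m$ with $(e)_m\neq0$, a pair of an upper parameter $e+m$ and a lower parameter $e$ in a hypergeometric series contributes to the $k$-th coefficient the factor $\frac{(e+m)_k}{(e)_k}=\frac{(e+k)_m}{(e)_m}$, where the right-hand side is the definition when $e$ is a negative integer. Put $$P(k)=\prod_{i=1}^r\frac{(e_i+k)_{m_i}}{(e_i)_{m_i}},\qquad D=\sum_{j=0}^{n}\frac{\Delta^jP(0)}{j!}\,(\alpha)_j(\beta)_j\,(\gamma-\alpha-\beta-n)_{n-j},$$ where $\Delta P(k)=P(k+1)-P(k)$. Assume $(\gamma-\beta-n)_n\neq0$. 1. If $(\gamma-\alpha-n)_n\neq 0$ and $D\neq0$, then there are $f_1,\dots,f_n\in\mathbb{C}\setminus\{0\}$ such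 that for all $|x|<1$ both series below converge absolutely and $${}_{r+2}F_{r+1}\left(\begin{array}{c}\alpha,\beta,e_1+m_1,\dots,e_r+m_r\\ \gamma,e_1,\dots,e_r\end{array};x\right)=(1-x)^{\gamma-\alpha-\beta-n}\,{}_{n+2}F_{n+1}\left(\begin{array}{c}\gamma-\alpha-n,\gamma-\beta-n,f_1+1,\dots,f_n+1\\ \gamma,f_1,\dots,f_n\end{array};x\right).$$ 2. If $(e_i-\beta)_{m_i}\neq0$ for all $i$, then there are $f_1,\dots,f_n\in\mathbb{C}\setminus\{0\}$ (not necessarily those of part 1) such that for all $x$ with $|x|<1$ and $|x/(x-1)|<1$ both series below converge absolutely and $${}_{r+2}F_{r+1}\left(\begin{array}{c}\alpha,\beta,e_1+m_1,\dots,e_r+m_r\\ \gamma,e_1,\dots,e_r\end{array};x\right)=(1-x)^{-\alpha}\,{}_{n+2}F_{n+1}\left(\begin{array}{c}\alpha,\gamma-\beta-n,f_1+1,\dots,f_n+1\\ \gamma,f_1,\dots,f_n\end{array};\frac{x}{x-1}\right).$$ Powers of $1-x$ are principal values. -/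

import Mathlib

/-- The Pochhammer symbol `(a)_k = a (a + 1) ⋯ (a + k - 1)`. -/
noncomputable def poch (a : ℂ) (k : ℕ) : ℂ :=
  (ascPochhammer ℂ k).eval a

/-- The generalized hypergeometric series `ₚF_q(a; b; x)`, for lower parameters `b` none of which
is a nonpositive integer. -/
noncomputable def genHypergeometric {p q : ℕ} (a : Fin p → ℂ) (b : Fin q → ℂ) (x : ℂ) : ℂ :=
  ∑' k : ℕ, (∏ i, poch (a i) k) / ((∏ j, poch (b j) k) * (k.factorial : ℂ)) * x ^ k

/-- The product over `i` of the ratios `(e i + m i)_k / (e i)_k`, each written as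
`(e i + k)_{m i} / (e i)_{m i}`. The two agree if `e i` is not a nonpositive integer, and the second
makes sense as soon as `(e i)_{m i} ≠ 0` (for `m i = 1`: as soon as `e i ≠ 0`). -/
noncomputable def shiftFactor {r : ℕ} (e : Fin r → ℂ) (m : Fin r → ℕ) (k : ℕ) : ℂ :=
  ∏ i, poch (e i + k) (m i) / poch (e i) (m i)

/-- The `k`-th term of the series
`ᵣ₊₂Fᵣ₊₁(α, β, e₁ + m₁, …, eᵣ + mᵣ; γ, e₁, …, eᵣ; x)`. -/
noncomputable def shiftedHypTerm {r : ℕ} (α β γ : ℂ) (e : Fin r → ℂ) (m : Fin r → ℕ)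
    (x : ℂ) (k : ℕ) : ℂ :=
  poch α k * poch β k / (poch γ k * (k.factorial : ℂ)) * shiftFactor e m k * x ^ k

/-- The function `ᵣ₊₂Fᵣ₊₁(α, β, e₁ + m₁, …, eᵣ + mᵣ; γ, e₁, …, eᵣ; x)`. -/
noncomputable def shiftedHyp {r : ℕ} (α β γ : ℂ) (e : Fin r → ℂ) (m : Fin r → ℕ) (x : ℂ) : ℂ :=
  ∑' k : ℕ, shiftedHypTerm α β γ e m x k

/-- The number `∑_{j ≤ n} (Δ^j P (0) / j!) (α)_j (β)_j (γ - α - β - n)_{n - j}`, where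
`P k = ∏ i, (e i + k)_{m i} / (e i)_{m i}`, `n = ∑ i, m i` and `Δ` is the forward difference. -/
noncomputable def eulerDiscriminant {r : ℕ} (α β γ : ℂ) (e : Fin r → ℂ) (m : Fin r → ℕ) : ℂ :=
  ∑ j ∈ Finset.range (∑ i, m i + 1),
    (fwdDiff 1)^[j] (shiftFactor e m) 0 / (j.factorial : ℂ) * poch α j * poch β j *
      poch (γ - α - β - ((∑ i, m i : ℕ) : ℂ)) (∑ i, m i - j)

theorem poch_ne_zero {a : ℂ} (ha : ∀ l : ℕ, a ≠ -(l : ℂ)) (k : ℕ) : poch a k ≠ 0 := by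
  intro h
  obtain ⟨l, _, hl⟩ := (ascPochhammer_eval_eq_zero_iff k a).1 h
  exact ha l (by rw [hl, neg_neg])

theorem poch_add (a : ℂ) (m k : ℕ) : poch a (m + k) = poch a m * poch (a + m) k := by
  simp [poch, ← ascPochhammer_mul, Polynomial.eval_comp]

/-- `shiftedHyp` is the generalized hypergeometric function if no `e i` is a nonpositive
integer. -/
theorem shiftedHyp_eq_genHypergeometric {r : ℕ} (α β γ : ℂ) (e : Fin r → ℂ) (m : Fin r → ℕ)
    (he : ∀ i, ∀ l : ℕ, e i ≠ -(l : ℂ)) (x : ℂ) :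
    shiftedHyp α β γ e m x =
      genHypergeometric (Fin.cons α (Fin.cons β fun i => e i + m i) : Fin (r + 2) → ℂ)
        (Fin.cons γ e : Fin (r + 1) → ℂ) x := by
  unfold shiftedHyp genHypergeometric
  congr 1
  funext k
  have h : shiftFactor e m k = (∏ i, poch (e i + m i) k) / ∏ i, poch (e i) k := by
    rw [shiftFactor, ← Finset.prod_div_distrib]
    refine Finset.prod_congr rfl fun i _ => ?_
    rw [div_eq_div_iff (poch_ne_zero (he i) _) (poch_ne_zero (he i) _), mul_comm, ← poch_add,
      mul_comm, ← poch_add, add_comm]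
  rw [shiftedHypTerm, h, Fin.prod_univ_succ, Fin.prod_univ_succ, Fin.prod_univ_succ]
  simp only [Fin.cons_zero, Fin.cons_succ]
  rw [div_mul_div_comm]
  congr 2 <;> ring

/-!
The coefficient weight `P k = ∏ i, (e i + k)_{m i} / (e i)_{m i}` is a polynomial of degree at most
`n` in `k`, so everything reduces to Gauss series weighted by a polynomial. Expand `P` in falling
factorials and apply the Chu–Vandermonde identity to each of them: Pfaff's transformation
`(α, β, x) ↦ (α, γ - β - n, x / (x - 1))` then holds coefficientwise near `0`, with `P` replaced by
another polynomial `Q` of degree at most `n`, and analytic continuation extends it to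
`‖x‖ < 1`, `re x < 1 / 2`. Applying it twice, once to each upper parameter, gives Euler's
transformation, first for `re x < 1 / 2` and then, by continuation again, in the unit disc.

The `n`-th coefficient of `Q` is `P (-β)` up to a nonzero factor, and for Euler's transformation
it is `Q (-α)`, that is, the number `D`, up to a nonzero factor. If it does not vanish, the new
weight has degree exactly `n` and the value `1` at `0`, hence equals `∏ j, (f j + k) / f j`, where
`-f j` are its roots.
-/

section Algebra

open Polynomial Finset

section CommRing

variable {R : Type*} [CommRing R]

theorem ascPochhammer_eval_add (a : R) (m k : ℕ) :
    (ascPochhammer R (m + k)).eval a =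
      (ascPochhammer R m).eval a * (ascPochhammer R k).eval (a + m) := by
  simp [← ascPochhammer_mul, eval_comp]

theorem ascPochhammer_eval_ne_zero [IsDomain R] {c : R} (hc : ∀ l : ℕ, c ≠ -(l : R)) (k : ℕ) :
    (ascPochhammer R k).eval c ≠ 0 := fun h => by
  obtain ⟨l, _, hl⟩ := (ascPochhammer_eval_eq_zero_iff k c).1 h
  exact hc l (by rw [hl, neg_neg])

theorem descPochhammer_eval_neg (a : R) (j : ℕ) :
    (descPochhammer R j).eval (-a) = (-1) ^ j * (ascPochhammer R j).eval a := by
  rw [← neg_neg a, ascPochhammer_eval_neg_eq_descPochhammer, neg_neg, ← mul_assoc, ← mul_pow]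
  simp

theorem descPochhammer_eval_eq_smeval (a : R) (j : ℕ) :
    (descPochhammer R j).eval a = (descPochhammer ℤ j).smeval a := by
  rw [← aeval_eq_smeval, ← descPochhammer_map (algebraMap ℤ R), eval_map_algebraMap]

theorem chu_vandermonde (b c : R) (M : ℕ) :
    ∑ l ∈ range (M + 1), (-1) ^ l * (M.choose l : R) * (ascPochhammer R l).eval b *
      (ascPochhammer R (M - l)).eval (c + l) = (ascPochhammer R M).eval (c - b) := by
  have hsum := Ring.descPochhammer_smeval_add M (Commute.all (-b) (c + M - 1))
  simp only [← descPochhammer_eval_eq_smeval, Nat.sum_antidiagonal_eq_sum_range_succ_mk] at hsum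
  rw [descPochhammer_eval_eq_ascPochhammer, show -b + (c + M - 1) - M + 1 = c - b by ring] at hsum
  rw [hsum]
  refine sum_congr rfl fun l hl => ?_
  have harg : c + M - 1 - ((M : R) - l) + 1 = c + l := by ring
  rw [descPochhammer_eval_neg, descPochhammer_eval_eq_ascPochhammer R (c + M - 1),
    Nat.cast_sub (mem_range_succ_iff.1 hl), harg]
  ring

theorem choose_add_mul_descFactorial (j M l : ℕ) :
    (j + M).choose (j + l) * (j + l).descFactorial j = (j + M).descFactorial j * M.choose l := by
  have h := (j + M).choose_mul (Nat.le_add_right j l)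
  simp only [Nat.add_sub_cancel_left] at h
  simp only [Nat.descFactorial_eq_factorial_mul_choose]
  linear_combination j.factorial * h

-- For `k < j` the truncated `k - j` is harmless, since `k.descFactorial j = 0`.
theorem chu_vandermonde_descFactorial (b c : R) (j N : ℕ) :
    ∑ k ∈ range (N + 1), (-1) ^ k * (N.choose k : R) * (ascPochhammer R (N - k)).eval (c + k) *
      ((descPochhammer R j).eval (-b) * (ascPochhammer R (k - j)).eval (c - b) *
        (k.descFactorial j : R)) =
      (ascPochhammer R N).eval b * (N.descFactorial j : R) := by
  rcases lt_or_ge N j with hNj | hjN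
  · rw [Nat.descFactorial_of_lt hNj, Nat.cast_zero, mul_zero]
    refine sum_eq_zero fun k hk => ?_
    rw [Nat.descFactorial_of_lt ((mem_range_succ_iff.1 hk).trans_lt hNj)]
    simp
  obtain ⟨M, rfl⟩ := Nat.exists_eq_add_of_le hjN
  have hsmall : ∀ k ∈ range j, (-1) ^ k * ((j + M).choose k : R) *
      (ascPochhammer R (j + M - k)).eval (c + k) * ((descPochhammer R j).eval (-b) *
        (ascPochhammer R (k - j)).eval (c - b) * (k.descFactorial j : R)) = 0 := fun k hk => by
    rw [Nat.descFactorial_of_lt (mem_range.1 hk), Nat.cast_zero, mul_zero, mul_zero]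
  have hvand := chu_vandermonde (c - b) (c + j) M
  rw [show c + j - (c - b) = b + j by ring] at hvand
  rw [add_assoc, sum_range_add, sum_eq_zero hsmall, zero_add, ascPochhammer_eval_add, ← hvand,
    mul_sum, sum_mul]
  refine sum_congr rfl fun l _ => ?_
  have hchoose := congrArg (Nat.cast (R := R)) (choose_add_mul_descFactorial j M l)
  have hsign : (-1 : R) ^ j * (-1) ^ j = 1 := by rw [← mul_pow]; simp
  rw [Nat.add_sub_add_left, Nat.add_sub_cancel_left, descPochhammer_eval_neg, pow_add,
    Nat.cast_add j l, ← add_assoc c]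
  push_cast at hchoose
  linear_combination (-1) ^ l * (ascPochhammer R j).eval b * (ascPochhammer R l).eval (c - b) *
    (ascPochhammer R (M - l)).eval (c + j + l) *
    (((j + M).choose (j + l) : R) * ((j + l).descFactorial j : R) * hsign + hchoose)

theorem monic_ascPochhammer_comp_mul_descPochhammer [IsDomain R] (a : R) (i j : ℕ) :
    ((ascPochhammer R i).comp (X + C a) * descPochhammer R j).Monic :=
  ((monic_ascPochhammer R i).comp_X_add_C a).mul (monic_descPochhammer R j)

theorem natDegree_ascPochhammer_comp_mul_descPochhammer [IsDomain R] (a : R) (i j : ℕ) :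
    ((ascPochhammer R i).comp (X + C a) * descPochhammer R j).natDegree = i + j := by
  rw [((monic_ascPochhammer R i).comp_X_add_C a).natDegree_mul (monic_descPochhammer R j),
    natDegree_comp, natDegree_X_add_C, ascPochhammer_natDegree, descPochhammer_natDegree, mul_one]

end CommRing

section Field

variable {K : Type*} [Field K]

/-- The coefficient of the falling factorial `z (z - 1) ⋯ (z - j + 1)` in the Newton expansion of
`P`. The differences are taken over `ℕ`, as in `eulerDiscriminant`. -/
def newtonCoeff (P : K[X]) (j : ℕ) : K :=
  (fwdDiff 1)^[j] (fun k : ℕ => P.eval (k : K)) 0 / (j.factorial : K)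

theorem newtonCoeff_eq_zero_of_natDegree_lt {P : K[X]} {j : ℕ} (h : P.natDegree < j) :
    newtonCoeff P j = 0 := by
  have hzero := congrFun (fwdDiff_iter_eq_zero_of_degree_lt h) 0
  simp only [fwdDiff_iter_eq_sum_shift, zero_add, nsmul_eq_mul, mul_one, Pi.zero_apply] at hzero
  simp only [newtonCoeff, fwdDiff_iter_eq_sum_shift, zero_add, smul_eq_mul, mul_one, hzero,
    zero_div]

/-- The polynomial weight that Pfaff's transformation of `₂F₁(a, b; c)` attaches to the weight `P`;
here `n` is a bound for the degree of `P`. -/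
noncomputable def pfaffWeight (b c : K) (n : ℕ) (P : K[X]) : K[X] :=
  C ((ascPochhammer K n).eval (c - b - n))⁻¹ * ∑ j ∈ range (n + 1),
    C (newtonCoeff P j * (descPochhammer K j).eval (-b)) *
      ((ascPochhammer K (n - j)).comp (X + C (c - b - n)) * descPochhammer K j)

theorem pfaffWeight_eval (b c : K) (n : ℕ) (P : K[X]) (z : K) :
    (pfaffWeight b c n P).eval z = (∑ j ∈ range (n + 1),
      newtonCoeff P j * (descPochhammer K j).eval (-b) *
        ((ascPochhammer K (n - j)).eval (c - b - n + z) * (descPochhammer K j).eval z)) /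
      (ascPochhammer K n).eval (c - b - n) := by
  simp only [pfaffWeight, eval_mul, eval_C, eval_finsetSum, eval_comp, eval_add, eval_X,
    add_comm z, inv_mul_eq_div]

theorem pfaffWeight_eval_zero {b c : K} {n : ℕ} (h : (ascPochhammer K n).eval (c - b - n) ≠ 0)
    (P : K[X]) : (pfaffWeight b c n P).eval 0 = P.eval 0 := by
  rw [pfaffWeight_eval, sum_range_succ', sum_eq_zero]
  · simp [newtonCoeff, h]
  · intro j _
    simp

theorem natDegree_pfaffWeight_le (b c : K) (n : ℕ) (P : K[X]) :
    (pfaffWeight b c n P).natDegree ≤ n := by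
  refine (natDegree_C_mul_le _ _).trans (natDegree_sum_le_of_forall_le _ _ fun j hj => ?_)
  refine (natDegree_C_mul_le _ _).trans ?_
  rw [natDegree_ascPochhammer_comp_mul_descPochhammer,
    Nat.sub_add_cancel (mem_range_succ_iff.1 hj)]

theorem mul_pfaffWeight_eval_natCast {b c : K} {n : ℕ}
    (h : (ascPochhammer K n).eval (c - b - n) ≠ 0) (P : K[X]) (k : ℕ) :
    (ascPochhammer K k).eval (c - b - n) * (pfaffWeight b c n P).eval (k : K) =
      ∑ j ∈ range (n + 1), newtonCoeff P j * ((descPochhammer K j).eval (-b) *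
        (ascPochhammer K (k - j)).eval (c - b) * (k.descFactorial j : K)) := by
  rw [pfaffWeight_eval, mul_div_assoc', div_eq_iff h, mul_sum, sum_mul]
  refine sum_congr rfl fun j hj => ?_
  rw [descPochhammer_eval_eq_descFactorial]
  rcases lt_or_ge k j with hkj | hjk
  · simp [Nat.descFactorial_of_lt hkj]
  have hjn : j ≤ n := mem_range_succ_iff.1 hj
  have hsplit := ascPochhammer_eval_add (c - b - n) k (n - j)
  rw [show k + (n - j) = n + (k - j) by omega, ascPochhammer_eval_add, sub_add_cancel] at hsplit
  linear_combination (-newtonCoeff P j * (descPochhammer K j).eval (-b) *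
    (k.descFactorial j : K)) * hsplit

variable [CharZero K]

theorem sum_range_succ_newtonCoeff_mul_descFactorial (P : K[X]) (N : ℕ) :
    ∑ j ∈ range (N + 1), newtonCoeff P j * (N.descFactorial j : K) = P.eval (N : K) := by
  have hnewton := shift_eq_sum_fwdDiff_iter (1 : ℕ) (fun k : ℕ => P.eval (k : K)) N 0
  simp only [zero_add, smul_eq_mul, mul_one, nsmul_eq_mul] at hnewton
  rw [hnewton]
  refine sum_congr rfl fun j _ => ?_
  have hfac : (j.factorial : K) ≠ 0 := Nat.cast_ne_zero.2 j.factorial_ne_zero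
  rw [newtonCoeff, Nat.descFactorial_eq_factorial_mul_choose, Nat.cast_mul]
  field_simp

theorem sum_newtonCoeff_mul_descPochhammer {P : K[X]} {n : ℕ} (hP : P.natDegree ≤ n) :
    ∑ j ∈ range (n + 1), C (newtonCoeff P j) * descPochhammer K j = P := by
  refine eq_of_infinite_eval_eq _ _
    (((Set.Ici_infinite n).image (Nat.cast_injective (R := K)).injOn).mono ?_)
  rintro _ ⟨N, hN, rfl⟩
  have hsub : range (n + 1) ⊆ range (N + 1) := range_mono (Nat.succ_le_succ hN)
  simp only [Set.mem_ofPred_eq, eval_finsetSum, eval_mul, eval_C,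
    descPochhammer_eval_eq_descFactorial]
  rw [← sum_range_succ_newtonCoeff_mul_descFactorial P N]
  refine sum_subset hsub fun j _ hj => ?_
  rw [newtonCoeff_eq_zero_of_natDegree_lt (hP.trans_lt (by simpa using hj)), zero_mul]

theorem sum_newtonCoeff_mul_eval_descPochhammer {P : K[X]} {n : ℕ} (hP : P.natDegree ≤ n) (z : K) :
    ∑ j ∈ range (n + 1), newtonCoeff P j * (descPochhammer K j).eval z = P.eval z := by
  conv_rhs => rw [← sum_newtonCoeff_mul_descPochhammer hP]
  simp only [eval_finsetSum, eval_mul, eval_C]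

theorem coeff_pfaffWeight (b c : K) {n : ℕ} {P : K[X]} (hP : P.natDegree ≤ n) :
    (pfaffWeight b c n P).coeff n = P.eval (-b) / (ascPochhammer K n).eval (c - b - n) := by
  rw [← sum_newtonCoeff_mul_eval_descPochhammer hP, pfaffWeight, coeff_C_mul, finsetSum_coeff,
    inv_mul_eq_div]
  congr 1
  refine sum_congr rfl fun j hj => ?_
  have hmonic := monic_ascPochhammer_comp_mul_descPochhammer (c - b - n) (n - j) j
  rw [Monic, leadingCoeff, natDegree_ascPochhammer_comp_mul_descPochhammer,
    Nat.sub_add_cancel (mem_range_succ_iff.1 hj)] at hmonic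
  rw [coeff_C_mul, hmonic, mul_one]

theorem sum_choose_mul_pfaffWeight_eval {b c : K} {n : ℕ}
    (h : (ascPochhammer K n).eval (c - b - n) ≠ 0) {P : K[X]} (hP : P.natDegree ≤ n) (N : ℕ) :
    ∑ k ∈ range (N + 1), (-1) ^ k * (N.choose k : K) * (ascPochhammer K (N - k)).eval (c + k) *
      ((ascPochhammer K k).eval (c - b - n) * (pfaffWeight b c n P).eval (k : K)) =
      (ascPochhammer K N).eval b * P.eval (N : K) := by
  simp only [mul_pfaffWeight_eval_natCast h, mul_sum]
  rw [sum_comm, ← sum_newtonCoeff_mul_eval_descPochhammer hP, mul_sum]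
  refine sum_congr rfl fun j _ => ?_
  rw [descPochhammer_eval_eq_descFactorial, mul_left_comm, ← chu_vandermonde_descFactorial b c,
    mul_sum]
  exact sum_congr rfl fun k _ => mul_left_comm _ _ _

theorem sum_antidiagonal_ordinaryHypergeometricCoefficient (a : K) {b c : K} {n : ℕ}
    (hc : ∀ l : ℕ, c ≠ -(l : K)) (h : (ascPochhammer K n).eval (c - b - n) ≠ 0) {P : K[X]}
    (hP : P.natDegree ≤ n) (N : ℕ) :
    ∑ p ∈ antidiagonal N, (-1) ^ p.1 *
      (ordinaryHypergeometricCoefficient a (c - b - n) c p.1 *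
        (pfaffWeight b c n P).eval (p.1 : K)) *
      ((ascPochhammer K p.2).eval (a + p.1) / (p.2.factorial : K)) =
      ordinaryHypergeometricCoefficient a b c N * P.eval (N : K) := by
  have hasc := fun k => ascPochhammer_eval_ne_zero hc k
  have hfac : ∀ i : ℕ, (i.factorial : K) ≠ 0 := fun i => Nat.cast_ne_zero.2 i.factorial_ne_zero
  rw [ordinaryHypergeometricCoefficient, mul_right_comm _ _ ((ascPochhammer K N).eval c)⁻¹,
    mul_assoc, ← sum_choose_mul_pfaffWeight_eval h hP, mul_sum,
    Nat.sum_antidiagonal_eq_sum_range_succ_mk]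
  refine sum_congr rfl fun k hk => ?_
  obtain ⟨l, rfl⟩ := Nat.exists_eq_add_of_le (mem_range_succ_iff.1 hk)
  have hck : (ascPochhammer K l).eval (c + k) ≠ 0 := by
    have := hasc (k + l)
    rw [ascPochhammer_eval_add] at this
    exact right_ne_zero_of_mul this
  rw [ordinaryHypergeometricCoefficient, Nat.add_sub_cancel_left, ascPochhammer_eval_add a,
    ascPochhammer_eval_add c, Nat.cast_add_choose]
  field_simp [hasc k, hfac k, hfac l, hfac (k + l)]

end Field

end Algebra

section Analysis

open Polynomial Finset Filter Topology

theorem hasSum_sum_antidiagonal {A α : Type*} [AddCommMonoid A] [HasAntidiagonal A]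
    [AddCommMonoid α] [TopologicalSpace α] [ContinuousAdd α] [RegularSpace α] {F : A × A → α}
    {s : α} (hF : HasSum F s) : HasSum (fun N => ∑ p ∈ antidiagonal N, F p) s := by
  have hsigma := (HasAntidiagonal.sigmaAntidiagonalEquivProd (A := A)).hasSum_iff.2 hF
  exact (hsigma.sigma fun N => hasSum_fintype _).congr_fun fun N => (sum_coe_sort _ F).symm

theorem norm_ascPochhammer_eval_le_ascFactorial {R : Type*} [SeminormedRing R] [NormOneClass R]
    {z : R} {M : ℕ} (hz : ‖z‖ ≤ M) (l : ℕ) :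
    ‖(ascPochhammer R l).eval z‖ ≤ (M.ascFactorial l : ℝ) := by
  induction l with
  | zero => simp
  | succ l ih =>
    have hfactor : ‖z + l‖ ≤ (M : ℝ) + l :=
      (norm_add_le _ _).trans (add_le_add hz (by simpa using Nat.norm_cast_le (α := R) l))
    rw [ascPochhammer_succ_eval, Nat.ascFactorial_succ, mul_comm (M + l), Nat.cast_mul,
      Nat.cast_add]
    exact (norm_mul_le _ _).trans (by gcongr)

theorem norm_ascPochhammer_eval_le_factorial_mul_two_pow {R : Type*} [SeminormedRing R]
    [NormOneClass R] {z : R} {M : ℕ} (hz : ‖z‖ ≤ M) (l : ℕ) :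
    ‖(ascPochhammer R l).eval z‖ ≤ l.factorial * 2 ^ (M + l) := by
  have hz' : ‖z‖ ≤ (M + 1 : ℕ) := hz.trans (Nat.cast_le.2 M.le_succ)
  refine (norm_ascPochhammer_eval_le_ascFactorial hz' l).trans ?_
  rw [Nat.ascFactorial_eq_factorial_mul_choose, Nat.cast_mul]
  gcongr
  exact_mod_cast Nat.choose_le_two_pow _ _

theorem hasSum_ascPochhammer_eval_div_factorial_mul_pow (a : ℂ) {x : ℂ} (hx : ‖x‖ < 1) :
    HasSum (fun l : ℕ => (ascPochhammer ℂ l).eval a / l.factorial * x ^ l)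
      ((1 - x) ^ (-a)) := by
  have hbinom := (Complex.one_div_one_sub_cpow_hasFPowerSeriesOnBall_zero a).hasSum (y := x)
    (by simpa [enorm_eq_nnnorm, ← NNReal.coe_lt_one] using hx)
  have hcoeff : ∀ l : ℕ, Ring.choose (a + l - 1) l = (ascPochhammer ℂ l).eval a / l.factorial :=
    fun l => by
      rw [eq_div_iff (Nat.cast_ne_zero.2 l.factorial_ne_zero), Ring.choose,
        show a + l - 1 - l + 1 = a by ring, mul_comm, ← nsmul_eq_mul,
        Ring.factorial_nsmul_multichoose_eq_ascPochhammer, ascPochhammer_smeval_eq_eval]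
  simpa [hcoeff, Complex.cpow_neg, mul_comm] using hbinom

theorem ne_one_of_norm_lt_one {R : Type*} [SeminormedRing R] [NormOneClass R] {x : R}
    (hx : ‖x‖ < 1) : x ≠ 1 := by
  rintro rfl
  simp at hx

theorem one_sub_mem_slitPlane {x : ℂ} (hx : ‖x‖ < 1) : 1 - x ∈ Complex.slitPlane := by
  rw [sub_eq_add_neg]
  exact Complex.mem_slitPlane_of_norm_lt_one (by rwa [norm_neg])

/-- The terms of the double series obtained by expanding every factor `(1 - x) ^ (-(a + k))` of
`(1 - x) ^ (-a) * ∑ k, u k * (x / (x - 1)) ^ k` by the binomial series. -/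
noncomputable def pfaffFamily (a : ℂ) (u : ℕ → ℂ) (x : ℂ) (p : ℕ × ℕ) : ℂ :=
  (-1) ^ p.1 * u p.1 * ((ascPochhammer ℂ p.2).eval (a + p.1) / p.2.factorial) * x ^ (p.1 + p.2)

theorem hasSum_pfaffFamily_row (a : ℂ) (u : ℕ → ℂ) {x : ℂ} (hx : ‖x‖ < 1) (k : ℕ) :
    HasSum (fun l : ℕ => pfaffFamily a u x (k, l))
      ((1 - x) ^ (-a) * (u k * (x / (x - 1)) ^ k)) := by
  have hx1 : 1 - x ≠ 0 := sub_ne_zero.2 (ne_one_of_norm_lt_one hx).symm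
  have hpow : (1 - x) ^ (-a) * (u k * (x / (x - 1)) ^ k) =
      (-1) ^ k * u k * x ^ k * (1 - x) ^ (-(a + k)) := by
    rw [neg_add, ← sub_eq_add_neg, Complex.cpow_sub _ _ hx1, Complex.cpow_natCast,
      ← neg_sub 1 x, div_neg, neg_pow, div_pow]
    ring
  rw [hpow]
  refine ((hasSum_ascPochhammer_eval_div_factorial_mul_pow (a + k) hx).mul_left
    ((-1) ^ k * u k * x ^ k)).congr_fun fun l => ?_
  rw [pfaffFamily]
  ring

theorem summable_pfaffFamily (a : ℂ) {u : ℕ → ℂ}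
    (hu : ∀ z : ℂ, ‖z‖ < 1 → Summable fun k => u k * z ^ k) {x : ℂ} (hx : ‖x‖ < 1 / 2) :
    Summable (pfaffFamily a u x) := by
  obtain ⟨M, hM⟩ := exists_nat_ge ‖a‖
  have hrow : Summable fun k => ‖u k * (2 * x) ^ k‖ := (hu (2 * x) (by simp; linarith)).norm
  have hcol : Summable fun l : ℕ => (2 * ‖x‖) ^ l :=
    summable_geometric_of_lt_one (by positivity) (by linarith)
  refine Summable.of_norm_bounded ((hrow.mul_of_nonneg hcol (fun _ => norm_nonneg _)
    fun _ => by positivity).mul_left (2 ^ M)) ?_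
  rintro ⟨k, l⟩
  have hak : ‖a + k‖ ≤ (M + k : ℕ) := by
    refine (norm_add_le _ _).trans ?_
    rw [Complex.norm_natCast, Nat.cast_add]
    gcongr
  have hasc : ‖(ascPochhammer ℂ l).eval (a + k) / l.factorial‖ ≤ 2 ^ (M + k + l) := by
    rw [norm_div, Complex.norm_natCast, div_le_iff₀' (by positivity)]
    exact norm_ascPochhammer_eval_le_factorial_mul_two_pow hak l
  calc ‖pfaffFamily a u x (k, l)‖
      = ‖u k‖ * ‖(ascPochhammer ℂ l).eval (a + k) / l.factorial‖ * ‖x‖ ^ (k + l) := by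
        simp only [pfaffFamily, norm_mul, norm_pow, norm_neg, norm_one, one_pow, one_mul]
    _ ≤ ‖u k‖ * 2 ^ (M + k + l) * ‖x‖ ^ (k + l) := by gcongr
    _ = 2 ^ M * (‖u k * (2 * x) ^ k‖ * (2 * ‖x‖) ^ l) := by
        simp only [norm_mul, norm_pow, Complex.norm_ofNat]
        ring

theorem hasSum_pfaffExpansion (a : ℂ) {u : ℕ → ℂ}
    (hu : ∀ z : ℂ, ‖z‖ < 1 → Summable fun k => u k * z ^ k) {x : ℂ} (hx : ‖x‖ < 1 / 2) :
    HasSum (fun N => (∑ p ∈ antidiagonal N, (-1) ^ p.1 * u p.1 *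
      ((ascPochhammer ℂ p.2).eval (a + p.1) / p.2.factorial)) * x ^ N)
      ((1 - x) ^ (-a) * ∑' k, u k * (x / (x - 1)) ^ k) := by
  have hfamily := summable_pfaffFamily a hu hx
  have hrow := hasSum_pfaffFamily_row a u (x := x) (by linarith)
  have htotal : (1 - x) ^ (-a) * ∑' k, u k * (x / (x - 1)) ^ k = ∑' p, pfaffFamily a u x p := by
    rw [hfamily.tsum_prod, ← tsum_mul_left]
    exact tsum_congr fun k => (hrow k).tsum_eq.symm
  rw [htotal]
  refine (hasSum_sum_antidiagonal hfamily.hasSum).congr_fun fun N => ?_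
  rw [sum_mul]
  exact sum_congr rfl fun p hp => by rw [pfaffFamily, HasAntidiagonal.mem_antidiagonal.1 hp]

section WeightedHyp

variable {𝕜 : Type*} [RCLike 𝕜]

theorem summable_ordinaryHypergeometricCoefficient_mul_natCast_pow (a b : 𝕜) {c : 𝕜}
    (hc : ∀ l : ℕ, c ≠ -(l : 𝕜)) (i : ℕ) {z : 𝕜} (hz : ‖z‖ < 1) :
    Summable fun k : ℕ => ordinaryHypergeometricCoefficient a b c k * (k : 𝕜) ^ i * z ^ k := by
  obtain ⟨ρ, hzρ, hρ⟩ := exists_between hz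
  have hratio : ∀ a c : 𝕜, Tendsto (fun k : ℕ => (a + k) / (c + k)) atTop (𝓝 1) := fun a c => by
    simpa using tendsto_add_mul_div_add_mul_atTop_nhds a c 1 one_ne_zero
  have hlim : Tendsto (fun k : ℕ => ‖(a + k) / (c + k) * ((b + k) / (1 + k)) *
      ((1 + k) / (0 + k)) ^ i * z‖) atTop (𝓝 ‖z‖) := by
    simpa using
      ((((hratio a c).mul (hratio b 1)).mul ((hratio 1 0).pow i)).mul_const z).norm
  refine summable_of_ratio_norm_eventually_le hρ ?_
  filter_upwards [hlim.eventually_le_const hzρ, eventually_ne_atTop 0] with k hk hk0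
  refine le_trans (le_of_eq ?_) (mul_le_mul_of_nonneg_right hk (norm_nonneg _))
  have hk1 : (1 : 𝕜) + k ≠ 0 := by simpa [add_comm] using Nat.cast_add_one_ne_zero (R := 𝕜) k
  have hasc := ascPochhammer_eval_ne_zero hc k
  have hck : c + k ≠ 0 := fun h => hc k (eq_neg_of_add_eq_zero_left h)
  have hfac : (k.factorial : 𝕜) ≠ 0 := Nat.cast_ne_zero.2 k.factorial_ne_zero
  rw [← norm_mul, ordinaryHypergeometricCoefficient, ascPochhammer_succ_eval,
    ascPochhammer_succ_eval, ascPochhammer_succ_eval, Nat.factorial_succ, zero_add, div_pow]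
  push_cast
  rw [add_comm (k : 𝕜) 1]
  congr 1
  field_simp
  ring

theorem summable_ordinaryHypergeometricCoefficient_mul_eval (a b : 𝕜) {c : 𝕜}
    (hc : ∀ l : ℕ, c ≠ -(l : 𝕜)) (P : 𝕜[X]) {z : 𝕜} (hz : ‖z‖ < 1) :
    Summable fun k : ℕ => ordinaryHypergeometricCoefficient a b c k * P.eval (k : 𝕜) * z ^ k := by
  have hmonomials := summable_sum (s := range (P.natDegree + 1)) fun i _ =>
    (summable_ordinaryHypergeometricCoefficient_mul_natCast_pow a b hc i hz).mul_left (P.coeff i)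
  refine hmonomials.congr fun k => ?_
  rw [eval_eq_sum_range, mul_sum, sum_mul]
  exact sum_congr rfl fun i _ => by ring

/-- The Gauss series `₂F₁(a, b; c; x)` with its `k`-th term multiplied by the value `P k` of a
polynomial; the hypergeometric series whose parameters differ by integers are of this form. -/
noncomputable def weightedHyp (a b c : 𝕜) (P : 𝕜[X]) (x : 𝕜) : 𝕜 :=
  ∑' k : ℕ, ordinaryHypergeometricCoefficient a b c k * P.eval (k : 𝕜) * x ^ k

theorem weightedHyp_comm (a b c : 𝕜) (P : 𝕜[X]) (x : 𝕜) :
    weightedHyp a b c P x = weightedHyp b a c P x :=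
  tsum_congr fun k => by
    rw [ordinaryHypergeometricCoefficient, mul_right_comm (k.factorial : 𝕜)⁻¹]

end WeightedHyp

theorem analyticOnNhd_tsum_mul_pow {R : ℝ} {u : ℕ → ℂ}
    (hu : ∀ z : ℂ, ‖z‖ < R → Summable fun k => u k * z ^ k) :
    AnalyticOnNhd ℂ (fun z => ∑' k, u k * z ^ k) (Metric.ball 0 R) := by
  refine DifferentiableOn.analyticOnNhd (fun z hz => ?_) Metric.isOpen_ball
  rw [mem_ball_zero_iff] at hz
  obtain ⟨ρ, hzρ, hρR⟩ := exists_between hz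
  have hρ : ‖(ρ : ℂ)‖ = ρ := by
    rw [Complex.norm_real, Real.norm_of_nonneg ((norm_nonneg z).trans hzρ.le)]
  have hdiff : DifferentiableOn ℂ (fun z => ∑' k, u k * z ^ k) (Metric.ball 0 ρ) := by
    refine Complex.differentiableOn_tsum_of_summable_norm (u := fun k => ‖u k * (ρ : ℂ) ^ k‖)
      (hu ρ (by rwa [hρ])).norm (fun k => by fun_prop) Metric.isOpen_ball fun k w hw => ?_
    rw [mem_ball_zero_iff] at hw
    rw [norm_mul, norm_mul, norm_pow, norm_pow, hρ]
    gcongr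
  exact (hdiff.differentiableAt
    (Metric.isOpen_ball.mem_nhds (by simpa using hzρ))).differentiableWithinAt

theorem analyticOnNhd_weightedHyp (a b : ℂ) {c : ℂ} (hc : ∀ l : ℕ, c ≠ -(l : ℂ)) (P : ℂ[X]) :
    AnalyticOnNhd ℂ (weightedHyp a b c P) (Metric.ball 0 1) :=
  analyticOnNhd_tsum_mul_pow fun _ hz =>
    summable_ordinaryHypergeometricCoefficient_mul_eval a b hc P hz

theorem analyticOnNhd_one_sub_cpow (a : ℂ) :
    AnalyticOnNhd ℂ (fun x : ℂ => (1 - x) ^ a) (Metric.ball 0 1) := fun _ hx =>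
  (analyticAt_const.sub analyticAt_id).cpow analyticAt_const
    (one_sub_mem_slitPlane (mem_ball_zero_iff.1 hx))

section Transformations

theorem norm_div_sub_one_lt_one_iff {x : ℂ} (hx : x ≠ 1) :
    ‖x / (x - 1)‖ < 1 ↔ x.re < 1 / 2 := by
  rw [norm_div, div_lt_one (norm_pos_iff.2 (sub_ne_zero.2 hx)),
    ← sq_lt_sq₀ (norm_nonneg _) (norm_nonneg _), ← Complex.normSq_eq_norm_sq,
    ← Complex.normSq_eq_norm_sq, Complex.normSq_sub]
  simp only [map_one, mul_one]
  constructor <;> intro h <;> linarith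

theorem div_sub_one_div_sub_one {K : Type*} [Field K] {x : K} (hx : x ≠ 1) :
    x / (x - 1) / (x / (x - 1) - 1) = x := by
  have hx1 : x - 1 ≠ 0 := sub_ne_zero.2 hx
  rw [show x / (x - 1) - 1 = 1 / (x - 1) by field_simp; ring]
  field_simp

theorem one_sub_div_sub_one {K : Type*} [Field K] {x : K} (hx : x ≠ 1) :
    1 - x / (x - 1) = (1 - x)⁻¹ := by
  have hx1 : x - 1 ≠ 0 := sub_ne_zero.2 hx
  rw [← neg_sub x 1, inv_neg]
  field_simp
  ring

variable (a : ℂ) {b c : ℂ} {n : ℕ} {P : ℂ[X]} {x : ℂ}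

theorem weightedHyp_pfaff_of_norm_lt_half (hc : ∀ l : ℕ, c ≠ -(l : ℂ))
    (hb : (ascPochhammer ℂ n).eval (c - b - n) ≠ 0) (hP : P.natDegree ≤ n) (hx : ‖x‖ < 1 / 2) :
    weightedHyp a b c P x =
      (1 - x) ^ (-a) * weightedHyp a (c - b - n) c (pfaffWeight b c n P) (x / (x - 1)) := by
  have hexp := hasSum_pfaffExpansion a (fun _ hz =>
    summable_ordinaryHypergeometricCoefficient_mul_eval a (c - b - n) hc (pfaffWeight b c n P) hz)
    hx
  simp only [sum_antidiagonal_ordinaryHypergeometricCoefficient a hc hb hP] at hexp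
  exact hexp.tsum_eq

theorem weightedHyp_pfaff (hc : ∀ l : ℕ, c ≠ -(l : ℂ))
    (hb : (ascPochhammer ℂ n).eval (c - b - n) ≠ 0) (hP : P.natDegree ≤ n) (hx : ‖x‖ < 1)
    (hre : x.re < 1 / 2) :
    weightedHyp a b c P x =
      (1 - x) ^ (-a) * weightedHyp a (c - b - n) c (pfaffWeight b c n P) (x / (x - 1)) := by
  let U : Set ℂ := Metric.ball 0 1 ∩ {w | w.re < 1 / 2}
  have hU : IsPreconnected U :=
    ((convex_ball 0 1).inter (convex_halfSpace_re_lt _)).isPreconnected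
  have hleft : AnalyticOnNhd ℂ (weightedHyp a b c P) U :=
    (analyticOnNhd_weightedHyp a b hc P).mono Set.inter_subset_left
  have hright : AnalyticOnNhd ℂ (fun x => (1 - x) ^ (-a) *
      weightedHyp a (c - b - n) c (pfaffWeight b c n P) (x / (x - 1))) U := by
    refine ((analyticOnNhd_one_sub_cpow (-a)).mono Set.inter_subset_left).mul ?_
    rintro w ⟨hw, hwre⟩
    have hw1 : w ≠ 1 := ne_one_of_norm_lt_one (mem_ball_zero_iff.1 hw)
    refine AnalyticAt.fun_comp (analyticOnNhd_weightedHyp _ _ hc _ _ ?_)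
      (analyticAt_id.div (analyticAt_id.sub analyticAt_const) (sub_ne_zero.2 hw1))
    exact mem_ball_zero_iff.2 ((norm_div_sub_one_lt_one_iff hw1).2 hwre)
  refine hleft.eqOn_of_preconnected_of_eventuallyEq hright hU (z₀ := 0) (by simp [U]) ?_
    ⟨mem_ball_zero_iff.2 hx, hre⟩
  filter_upwards [Metric.ball_mem_nhds (0 : ℂ) one_half_pos] with w hw
  exact weightedHyp_pfaff_of_norm_lt_half a hc hb hP (mem_ball_zero_iff.1 hw)

variable {a}

-- The substitution `x ↦ x / (x - 1)` is an involution, so Pfaff's transformation can be applied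
-- once to each of the two upper parameters.
theorem weightedHyp_euler_of_re_lt_half (hc : ∀ l : ℕ, c ≠ -(l : ℂ))
    (ha : (ascPochhammer ℂ n).eval (c - a - n) ≠ 0)
    (hb : (ascPochhammer ℂ n).eval (c - b - n) ≠ 0) (hP : P.natDegree ≤ n) (hx : ‖x‖ < 1)
    (hre : x.re < 1 / 2) :
    weightedHyp a b c P x = (1 - x) ^ (c - a - b - n) *
      weightedHyp (c - a - n) (c - b - n) c (pfaffWeight a c n (pfaffWeight b c n P)) x := by
  have hx1 : x ≠ 1 := ne_one_of_norm_lt_one hx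
  have hy : ‖x / (x - 1)‖ < 1 := (norm_div_sub_one_lt_one_iff hx1).2 hre
  have hyre : (x / (x - 1)).re < 1 / 2 :=
    (norm_div_sub_one_lt_one_iff (ne_one_of_norm_lt_one hy)).1 (by
      rwa [div_sub_one_div_sub_one hx1])
  have hpow : (1 - x) ^ (-a) * (1 - x / (x - 1)) ^ (-(c - b - n)) = (1 - x) ^ (c - a - b - n) := by
    rw [one_sub_div_sub_one hx1,
      Complex.inv_cpow _ _ (Complex.slitPlane_arg_ne_pi (one_sub_mem_slitPlane hx)),
      Complex.cpow_neg _ (c - b - n), inv_inv, ← Complex.cpow_add _ _ (sub_ne_zero.2 hx1.symm)]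
    ring_nf
  calc weightedHyp a b c P x
      = (1 - x) ^ (-a) * weightedHyp (c - b - n) a c (pfaffWeight b c n P) (x / (x - 1)) := by
        rw [weightedHyp_pfaff a hc hb hP hx hre, weightedHyp_comm a]
    _ = (1 - x) ^ (-a) * ((1 - x / (x - 1)) ^ (-(c - b - n)) *
          weightedHyp (c - b - n) (c - a - n) c (pfaffWeight a c n (pfaffWeight b c n P)) x) := by
        rw [weightedHyp_pfaff (c - b - n) hc ha (natDegree_pfaffWeight_le b c n P) hy hyre,
          div_sub_one_div_sub_one hx1]
    _ = _ := by rw [← mul_assoc, hpow, weightedHyp_comm]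

theorem weightedHyp_euler (hc : ∀ l : ℕ, c ≠ -(l : ℂ))
    (ha : (ascPochhammer ℂ n).eval (c - a - n) ≠ 0)
    (hb : (ascPochhammer ℂ n).eval (c - b - n) ≠ 0) (hP : P.natDegree ≤ n) (hx : ‖x‖ < 1) :
    weightedHyp a b c P x = (1 - x) ^ (c - a - b - n) *
      weightedHyp (c - a - n) (c - b - n) c (pfaffWeight a c n (pfaffWeight b c n P)) x := by
  refine (analyticOnNhd_weightedHyp a b hc P).eqOn_of_preconnected_of_eventuallyEq
    ((analyticOnNhd_one_sub_cpow _).mul (analyticOnNhd_weightedHyp (c - a - n) (c - b - n) hc _))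
    (convex_ball 0 1).isPreconnected (z₀ := 0) (by simp) ?_ (mem_ball_zero_iff.2 hx)
  filter_upwards [Metric.ball_mem_nhds (0 : ℂ) one_half_pos] with w hw
  rw [mem_ball_zero_iff] at hw
  exact weightedHyp_euler_of_re_lt_half hc ha hb hP (hw.trans one_half_lt_one)
    ((Complex.re_le_norm w).trans_lt hw)

end Transformations

end Analysis

section ShiftedParameters

open Polynomial Finset

variable {r : ℕ}

theorem exists_forall_eval_eq_prod_add_div {K : Type*} [Field K] {n : ℕ} {Q : K[X]}
    (hsplits : Q.Splits) (hdeg : Q.natDegree = n) (hQ0 : Q.eval 0 = 1) :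
    ∃ f : Fin n → K, (∀ j, f j ≠ 0) ∧ ∀ z, Q.eval z = ∏ j, (f j + z) / f j := by
  obtain ⟨roots, hroots⟩ : ∃ l : List K, (l : Multiset K) = Q.roots := ⟨_, Q.roots.coe_toList⟩
  obtain rfl : roots.length = n := by
    rw [← hdeg, hsplits.natDegree_eq_card_roots, ← hroots, Multiset.coe_card]
  have heval : ∀ z, Q.eval z = Q.leadingCoeff * ∏ j : Fin roots.length, (z - roots[j]) := by
    intro z
    rw [hsplits.eval_eq_prod_roots, ← hroots, Multiset.map_coe, Multiset.prod_coe]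
    exact congrArg _ (Fin.prod_univ_fun_getElem roots (z - ·)).symm
  have hne : Q.leadingCoeff ≠ 0 ∧ ∏ j : Fin roots.length, (0 - roots[j]) ≠ 0 :=
    mul_ne_zero_iff.1 (by rw [← heval, hQ0]; exact one_ne_zero)
  refine ⟨fun j => 0 - roots[j], fun j => prod_ne_zero_iff.1 hne.2 j (mem_univ j), fun z => ?_⟩
  rw [← div_one (Q.eval z), ← hQ0, heval, heval, mul_div_mul_left _ _ hne.1, ← prod_div_distrib]
  exact prod_congr rfl fun j _ => by simp only [zero_sub, sub_eq_neg_add z]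

theorem exists_shiftFactor_eq_pfaffWeight_eval {b c : ℂ} {n : ℕ} {P : ℂ[X]}
    (hb : poch (c - b - n) n ≠ 0) (hP : P.natDegree ≤ n) (hP0 : P.eval 0 = 1)
    (hPb : P.eval (-b) ≠ 0) :
    ∃ f : Fin n → ℂ, (∀ j, f j ≠ 0) ∧
      ∀ k : ℕ, shiftFactor f (fun _ => 1) k = (pfaffWeight b c n P).eval (k : ℂ) := by
  have hcoeff : (pfaffWeight b c n P).coeff n ≠ 0 := by
    rw [coeff_pfaffWeight b c hP]
    exact div_ne_zero hPb hb
  obtain ⟨f, hf, hfeval⟩ := exists_forall_eval_eq_prod_add_div (IsAlgClosed.splits _)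
    ((natDegree_pfaffWeight_le b c n P).antisymm (le_natDegree_of_ne_zero hcoeff))
    ((pfaffWeight_eval_zero hb P).trans hP0)
  exact ⟨f, hf, fun k => by simp [hfeval, shiftFactor, poch]⟩

theorem hasSum_shiftedHypTerm (a b : ℂ) {c : ℂ} (hc : ∀ l : ℕ, c ≠ -(l : ℂ)) {e : Fin r → ℂ}
    {m : Fin r → ℕ} {P : ℂ[X]} (hP : ∀ k : ℕ, shiftFactor e m k = P.eval (k : ℂ)) {x : ℂ}
    (hx : ‖x‖ < 1) : HasSum (shiftedHypTerm a b c e m x) (weightedHyp a b c P x) := by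
  refine (summable_ordinaryHypergeometricCoefficient_mul_eval a b hc P hx).hasSum.congr_fun
    fun k => ?_
  rw [shiftedHypTerm, hP, ordinaryHypergeometricCoefficient, poch, poch, poch, div_eq_mul_inv,
    mul_inv]
  ring

/-- The polynomial `∏ i, (e i + z)_{m i} / (e i)_{m i}` in `z`, which takes the value
`shiftFactor e m k` at `k`. -/
noncomputable def shiftPolynomial (e : Fin r → ℂ) (m : Fin r → ℕ) : ℂ[X] :=
  ∏ i, C (poch (e i) (m i))⁻¹ * (ascPochhammer ℂ (m i)).comp (X + C (e i))

theorem shiftPolynomial_eval (e : Fin r → ℂ) (m : Fin r → ℕ) (z : ℂ) :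
    (shiftPolynomial e m).eval z = ∏ i, poch (e i + z) (m i) / poch (e i) (m i) := by
  simp only [shiftPolynomial, eval_prod, eval_mul, eval_C, eval_comp, eval_add, eval_X,
    add_comm z, inv_mul_eq_div, poch]

theorem natDegree_shiftPolynomial_le (e : Fin r → ℂ) (m : Fin r → ℕ) :
    (shiftPolynomial e m).natDegree ≤ ∑ i, m i := by
  refine (natDegree_prod_le _ _).trans (sum_le_sum fun i _ => ?_)
  refine (natDegree_C_mul_le _ _).trans ?_
  rw [natDegree_comp, natDegree_X_add_C, ascPochhammer_natDegree, mul_one]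

theorem shiftFactor_eq_shiftPolynomial_eval (e : Fin r → ℂ) (m : Fin r → ℕ) (k : ℕ) :
    shiftFactor e m k = (shiftPolynomial e m).eval (k : ℂ) :=
  (shiftPolynomial_eval e m k).symm

theorem shiftPolynomial_eval_zero {e : Fin r → ℂ} {m : Fin r → ℕ}
    (he : ∀ i, poch (e i) (m i) ≠ 0) : (shiftPolynomial e m).eval 0 = 1 := by
  simp only [shiftPolynomial_eval, add_zero, div_self (he _), prod_const_one]

theorem shiftPolynomial_eval_neg_ne_zero {b : ℂ} {e : Fin r → ℂ} {m : Fin r → ℕ}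
    (he : ∀ i, poch (e i) (m i) ≠ 0) (heb : ∀ i, poch (e i - b) (m i) ≠ 0) :
    (shiftPolynomial e m).eval (-b) ≠ 0 := by
  simp only [shiftPolynomial_eval, ← sub_eq_add_neg]
  exact prod_ne_zero_iff.2 fun i _ => div_ne_zero (heb i) (he i)

theorem newtonCoeff_shiftPolynomial (e : Fin r → ℂ) (m : Fin r → ℕ) (j : ℕ) :
    newtonCoeff (shiftPolynomial e m) j =
      (fwdDiff 1)^[j] (shiftFactor e m) 0 / (j.factorial : ℂ) := by
  rw [newtonCoeff, funext (shiftFactor_eq_shiftPolynomial_eval e m)]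

theorem pfaffWeight_shiftPolynomial_eval_neg (α β γ : ℂ) (e : Fin r → ℂ) (m : Fin r → ℕ) :
    (pfaffWeight β γ (∑ i, m i) (shiftPolynomial e m)).eval (-α) =
      eulerDiscriminant α β γ e m / poch (γ - β - (∑ i, m i : ℕ)) (∑ i, m i) := by
  rw [pfaffWeight_eval, eulerDiscriminant, ← poch]
  congr 1
  refine sum_congr rfl fun j _ => ?_
  have hsign : (-1 : ℂ) ^ j * (-1) ^ j = 1 := by rw [← mul_pow]; simp
  have harg : γ - β - (∑ i, m i : ℕ) + -α = γ - α - β - (∑ i, m i : ℕ) := by ring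
  rw [newtonCoeff_shiftPolynomial, descPochhammer_eval_neg, descPochhammer_eval_neg, harg]
  simp only [poch]
  linear_combination ((fwdDiff 1)^[j] (shiftFactor e m) 0 / (j.factorial : ℂ) *
    (ascPochhammer ℂ j).eval α * (ascPochhammer ℂ j).eval β *
    (ascPochhammer ℂ (∑ i, m i - j)).eval (γ - α - β - (∑ i, m i : ℕ))) * hsign

end ShiftedParameters

theorem mainTheorem4 {r : ℕ} (α β γ : ℂ) (e : Fin r → ℂ) (m : Fin r → ℕ) (n : ℕ)
    (hm : ∀ i, 0 < m i) (hn : n = ∑ i, m i)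
    (he : ∀ i, poch (e i) (m i) ≠ 0)
    (hγ : ∀ l : ℕ, γ ≠ -(l : ℂ))
    (hβ : poch (γ - β - n) n ≠ 0) :
    (poch (γ - α - n) n ≠ 0 → eulerDiscriminant α β γ e m ≠ 0 →
      ∃ f : Fin n → ℂ, (∀ j, f j ≠ 0) ∧ ∀ x : ℂ, ‖x‖ < 1 →
        Summable (shiftedHypTerm α β γ e m x) ∧
        Summable (shiftedHypTerm (γ - α - n) (γ - β - n) γ f (fun _ => 1) x) ∧
        shiftedHyp α β γ e m x =
          (1 - x) ^ (γ - α - β - n) *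
            shiftedHyp (γ - α - n) (γ - β - n) γ f (fun _ => 1) x) ∧
    ((∀ i, poch (e i - β) (m i) ≠ 0) →
      ∃ f : Fin n → ℂ, (∀ j, f j ≠ 0) ∧ ∀ x : ℂ, ‖x‖ < 1 → ‖x / (x - 1)‖ < 1 →
        Summable (shiftedHypTerm α β γ e m x) ∧
        Summable (shiftedHypTerm α (γ - β - n) γ f (fun _ => 1) (x / (x - 1))) ∧
        shiftedHyp α β γ e m x =
          (1 - x) ^ (-α) *
            shiftedHyp α (γ - β - n) γ f (fun _ => 1) (x / (x - 1))) := by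
  subst hn
  have hP := natDegree_shiftPolynomial_le e m
  have hP0 := shiftPolynomial_eval_zero he
  have hleft := fun x (hx : ‖x‖ < 1) =>
    hasSum_shiftedHypTerm α β hγ (shiftFactor_eq_shiftPolynomial_eval e m) hx
  refine ⟨fun hα hD => ?_, fun heβ => ?_⟩
  · have hQα : (pfaffWeight β γ (∑ i, m i) (shiftPolynomial e m)).eval (-α) ≠ 0 := by
      rw [pfaffWeight_shiftPolynomial_eval_neg]
      exact div_ne_zero hD hβ
    obtain ⟨f, hf, hfeval⟩ := exists_shiftFactor_eq_pfaffWeight_eval hα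
      (natDegree_pfaffWeight_le β γ _ _) ((pfaffWeight_eval_zero hβ _).trans hP0) hQα
    refine ⟨f, hf, fun x hx => ?_⟩
    have hright := hasSum_shiftedHypTerm (γ - α - (∑ i, m i : ℕ)) (γ - β - (∑ i, m i : ℕ)) hγ
      hfeval hx
    refine ⟨(hleft x hx).summable, hright.summable, ?_⟩
    rw [shiftedHyp, shiftedHyp, (hleft x hx).tsum_eq, hright.tsum_eq]
    exact weightedHyp_euler hγ hα hβ hP hx
  · obtain ⟨f, hf, hfeval⟩ := exists_shiftFactor_eq_pfaffWeight_eval hβ hP hP0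
      (shiftPolynomial_eval_neg_ne_zero he heβ)
    refine ⟨f, hf, fun x hx hx' => ?_⟩
    have hright := hasSum_shiftedHypTerm α (γ - β - (∑ i, m i : ℕ)) hγ hfeval hx'
    refine ⟨(hleft x hx).summable, hright.summable, ?_⟩
    rw [shiftedHyp, shiftedHyp, (hleft x hx).tsum_eq, hright.tsum_eq]
    exact weightedHyp_pfaff α hγ hβ hP hx
      ((norm_div_sub_one_lt_one_iff (ne_one_of_norm_lt_one hx)).1 hx')
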